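/- Let $K$ be a field and let $2\le k\le \ell\le d$. Let $\mathcal Y=[k]\times[\ell]$, identified with $[k\ell]$ by sending $(i,j)$ to $(j-1)k+i$, and for $j\in[\ell]$ let $C_j=\{(i,j): i\in[k]\}$. Let $P=(p_{u,b})_{u\in[d],\,b\in\mathcal Y}$ be a matrix of indeterminates and $R=K[p_{u,b}]$. For $A\subseteq[d]$ and $B\subseteq\mathcal Y$ with $|A|=|B|$ let $[A\mid B]$ be the minor of $P$ with rows $A$ and columns $B$, both in increasing order. Let $\prec_{\mathrm{lex}}$ be the lexicographic term order with $p_{u,b}>p_{v,c}$ iff $u<v$, or $u=v$ and $b<c$. A Gröbner basis of an ideal $J\subseteq R$ is a finite subset of $J$ whose leading terms generate the ideal spanned by the leading terms of all elements of $J$. Let $\Lambda^2$ be the set of all $2$-subsets of $\mathcal Y$ contained in some $C_j$, and let $J_\Lambda$ be the ideal generated by all $[A\mid B]$ with $B\in\Lambda^2$, $|A|=2$. Let $I_0$ be the ideal generated by all $[A\mid B]$ with $B\in\Lambda^2$, $|A|=2$, and all $\ell$-minors of $P$. For $S\subseteq\mathcal Y$ let $I_S=\langle p_{u,b}: u\in[d],\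 b\in S\rangle+J_\Lambda$. Let $$G(I_0)=\{[A\mid B]: |A|=2,\ B\in\Lambda^2\}\cup\{[A\mid B]: |A|=|B|=\ell,\ |B\cap C_j|\le 1\text{ for each } j\},$$ and let $\mathcal L$ be the family of all sets $\{(i_1,j_1),\dots,(i_k,j_k)\}\subseteq\mathcal Y$ with $|\{i_1,\dots,i_k\}|=k$ and $|\{j_1,\dots,j_k\}|\ge 2$. **Theorem 2.4.** (1) The set $G(I_0)$ is a minimal generating set of $I_0$ (it generates $I_0$, and no element of it lies in the ideal generated by the others), and it is a Gröbner basis of $I_0$ with respect to $\prec_{\mathrm{lex}}$. (2) For every $S\in\mathcal L$, the natural generators of $I_S$, namely the variables $p_{u,b}$ with $u\in[d]$, $b\in S$, together with all $[A\mid B]$ with $|A|=2$, $B\in\Lambda^2$, generate $I_S$ and form a Gröbner basis of $I_S$ with respect to $\prec_{\mathrm{lex}}$. The same holds for the smaller set that consists of these variables and of the minors $[A\mid B]$ with $|A|=2$, $|B|=2$ and $B\subseteq C_j\setminus S$ for some $j$. -/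

import Mathlib

noncomputable section

namespace HiddenCI

/-- Column indices of the generic matrix: the set `𝒴 = [k] × [ℓ]`. The pair `(i, j)` is stored as
`toLex (j, i)`, so that the linear order is first by the block `j`, then by the position `i` inside
the block. This is the order of the numbers `(j - 1) k + i` in the identification `𝒴 ≅ [kℓ]`. -/
abbrev Col (k ℓ : ℕ) : Type := Fin ℓ ×ₗ Fin k

/-- The column index `𝒴_{i,j}`. -/
def col {k ℓ : ℕ} (i : Fin k) (j : Fin ℓ) : Col k ℓ := toLex (j, i)

/-- The variables `p_{u,b}` with row `u ∈ [d]` and column `b ∈ 𝒴`, ordered by row, then column. -/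
abbrev Var (k ℓ d : ℕ) : Type := Fin d ×ₗ Col k ℓ

/-- The variable index of `p_{u,b}`. -/
def var {k ℓ d : ℕ} (u : Fin d) (b : Col k ℓ) : Var k ℓ d := toLex (u, b)

/-- The polynomial ring `R = K[p_{u,b}]`. -/
abbrev PolyRing (K : Type*) [Field K] (k ℓ d : ℕ) : Type _ := MvPolynomial (Var k ℓ d) K

/-- The lexicographic monomial order on the variables; an index which is smaller in `Var` gives a
larger variable: `p_{u,b} > p_{v,c}` iff `u < v`, or `u = v` and `b < c`. -/
def lexOrder (k ℓ d : ℕ) : MonomialOrder (Var k ℓ d) := MonomialOrder.lex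

/-- The minor `[A | B]`, with the rows and the columns taken in increasing order. -/
def minor (K : Type*) [Field K] {k ℓ d : ℕ} (A : Finset (Fin d)) (B : Finset (Col k ℓ))
    (h : A.card = B.card) : PolyRing K k ℓ d :=
  Matrix.det (Matrix.of fun r c : Fin A.card =>
    (MvPolynomial.X (var (A.orderEmbOfFin rfl r) (B.orderEmbOfFin h.symm c)) : PolyRing K k ℓ d))

/-- The block `C_j = {𝒴_{i,j} : i ∈ [k]}`. -/
def block {k ℓ : ℕ} (j : Fin ℓ) : Finset (Col k ℓ) :=
  Finset.univ.image fun i : Fin k => col i j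

/-- The hypergraph `Δ^t` of all `t`-subsets of `𝒴`. -/
def allEdges (k ℓ t : ℕ) : Set (Finset (Col k ℓ)) := {B | B.card = t}

/-- The hypergraph `Λ^s` of all `s`-subsets of the blocks `C_j`. -/
def blockEdges (k ℓ s : ℕ) : Set (Finset (Col k ℓ)) :=
  {B | ∃ j : Fin ℓ, B ⊆ block j ∧ B.card = s}

/-- The minors `[A | B]` with `A ⊆ [d]`, `B` a hyperedge of `E`, and `|A| = |B|`. -/
def hyperedgeMinors (K : Type*) [Field K] {k ℓ : ℕ} (d : ℕ) (E : Set (Finset (Col k ℓ))) :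
    Set (PolyRing K k ℓ d) :=
  {f | ∃ (A : Finset (Fin d)) (B : Finset (Col k ℓ)) (h : A.card = B.card),
    B ∈ E ∧ f = minor K A B h}

/-- The determinantal hyperedge ideal of the hypergraph `E`. -/
def hyperedgeIdeal (K : Type*) [Field K] {k ℓ : ℕ} (d : ℕ) (E : Set (Finset (Col k ℓ))) :
    Ideal (PolyRing K k ℓ d) :=
  Ideal.span (hyperedgeMinors K d E)

/-- The ideal `I_0` of the hypergraph `Λ^2 ∪ Δ^ℓ`. -/
def I₀ (K : Type*) [Field K] (k ℓ d : ℕ) : Ideal (PolyRing K k ℓ d) :=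
  hyperedgeIdeal K d (blockEdges k ℓ 2 ∪ allEdges k ℓ ℓ)

/-- The set `G(I_0)`: the 2-minors within the blocks, and the `ℓ`-minors whose columns meet each
block at most once. -/
def G₀ (K : Type*) [Field K] (k ℓ d : ℕ) : Set (PolyRing K k ℓ d) :=
  hyperedgeMinors K d (blockEdges k ℓ 2) ∪
    hyperedgeMinors K d {B | B.card = ℓ ∧ ∀ j : Fin ℓ, (B ∩ block j).card ≤ 1}

/-- The variables `p_{u,b}` with `u ∈ [d]` and `b ∈ S`. -/
def columnVars (K : Type*) [Field K] {k ℓ : ℕ} (d : ℕ) (S : Finset (Col k ℓ)) :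
    Set (PolyRing K k ℓ d) :=
  {f | ∃ (u : Fin d) (b : Col k ℓ), b ∈ S ∧ f = MvPolynomial.X (var u b)}

/-- The ideal `I_S = ⟨p_{u,b} : u ∈ [d], b ∈ S⟩ + ⟨2-minors within the blocks⟩`. -/
def I (K : Type*) [Field K] {k ℓ : ℕ} (d : ℕ) (S : Finset (Col k ℓ)) :
    Ideal (PolyRing K k ℓ d) :=
  Ideal.span (columnVars K d S) + hyperedgeIdeal K d (blockEdges k ℓ 2)

/-- The generators in the definition of `I_S`. -/
def gens (K : Type*) [Field K] {k ℓ : ℕ} (d : ℕ) (S : Finset (Col k ℓ)) :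
    Set (PolyRing K k ℓ d) :=
  columnVars K d S ∪ hyperedgeMinors K d (blockEdges k ℓ 2)

/-- The generators of `I_S` without the redundant ones: the variables in the columns `S`, and the
2-minors of the submatrices with column set `C_j \ S`. -/
def reducedGens (K : Type*) [Field K] {k ℓ : ℕ} (d : ℕ) (S : Finset (Col k ℓ)) :
    Set (PolyRing K k ℓ d) :=
  columnVars K d S ∪ hyperedgeMinors K d {B | ∃ j : Fin ℓ, B ⊆ block j \ S ∧ B.card = 2}

/-- The family `𝓛` of all sets `{𝒴_{i_1,j_1}, …, 𝒴_{i_k,j_k}}` with `|{i_1, …, i_k}| = k` and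
`|{j_1, …, j_k}| ≥ 2`. -/
def 𝓛 (k ℓ : ℕ) : Set (Finset (Col k ℓ)) :=
  {S | ∃ (i : Fin k → Fin k) (j : Fin k → Fin ℓ),
    S = Finset.univ.image (fun r => col (i r) (j r)) ∧
    (Finset.univ.image i).card = k ∧ 2 ≤ (Finset.univ.image j).card}

/-- `G` is a Gröbner basis of the ideal `J` with respect to the monomial order `m`: a finite subset
of `J` whose leading terms generate the ideal of the leading terms of all elements of `J`. -/
def IsGroebnerBasis {σ K : Type*} [Field K] (m : MonomialOrder σ)
    (G : Set (MvPolynomial σ K)) (J : Ideal (MvPolynomial σ K)) : Prop :=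
  G.Finite ∧ G ⊆ (J : Set (MvPolynomial σ K)) ∧
    Ideal.span (m.leadingTerm '' G) =
      Ideal.span (m.leadingTerm '' (J : Set (MvPolynomial σ K)))

/-- `G` is a minimal generating set of `J`: it generates `J` and no element can be left out. -/
def IsMinimalGeneratingSet {R : Type*} [CommRing R] (G : Set R) (J : Ideal R) : Prop :=
  Ideal.span G = J ∧ ∀ g ∈ G, g ∉ Ideal.span (G \ {g})

end HiddenCI

end

open MvPolynomial
open scoped MonomialOrder

namespace HiddenCI

/-! A finite `G ⊆ J` of nonzero polynomials is a Gröbner basis once every nonzero `f` supported on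
standard monomials (divisible by no leading monomial of `G`) lies outside `J`; see
`isGroebnerBasis_of_standard`. To certify this, one finds a point over the algebraic closure at
which `J` vanishes and `f` does not.

All points used have the form `p_{u,b} = x_{u,j} y_b` for `b ∈ C_j`, so the 2-minors within blocks
vanish. A monomial avoiding the diagonals of these minors is determined by its image under the
substitution, because its exponents in a block are determined by their row and column sums
(`eq_of_sums_eq`). Hence `f` becomes a nonzero polynomial in `x` and `y`.

For `I_S` it remains to put `y_b = 0` for `b ∈ S`. For `I_0` the columns of the matrix `x` must also
be linearly dependent. Standardness with respect to the transversal `ℓ`-minors says that no monomial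
of the image contains a chain `x_{u_0,0} ⋯ x_{u_{ℓ-1},ℓ-1}`, and `exists_dependent_eval_ne_zero`
then supplies `x`, by induction on the number of rows with the corner entry sent to infinity.

Minimality is separate: the 0-1 matrix supported on the diagonal of one generator of `G(I_0)`
annihilates all the others. -/

/-- The monomial `m` is divisible by `x_{u_0,0} ⋯ x_{u_{ℓ-1},ℓ-1}` for some
`u_0 < ⋯ < u_{ℓ-1} < d`. -/
def HasChain {τ : Type*} (d ℓ : ℕ) (m : (ℕ × ℕ) ⊕ τ →₀ ℕ) : Prop :=
  ∃ u : ℕ → ℕ, (∀ i j, i < j → j < ℓ → u i < u j) ∧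
    ∀ j < ℓ, u j < d ∧ m (Sum.inl (u j, j)) ≠ 0

theorem HasChain.mono {τ : Type*} {d ℓ : ℕ} {m : (ℕ × ℕ) ⊕ τ →₀ ℕ} (h : HasChain d ℓ m) :
    HasChain (d + 1) ℓ m := by
  obtain ⟨u, hu, h⟩ := h
  exact ⟨u, hu, fun j hj => ⟨(h j hj).1.trans (Nat.lt_succ_self d), (h j hj).2⟩⟩

theorem HasChain.snoc {τ : Type*} {d ℓ : ℕ} {m : (ℕ × ℕ) ⊕ τ →₀ ℕ} (h : HasChain d ℓ m)
    (ht : m (Sum.inl (d, ℓ)) ≠ 0) : HasChain (d + 1) (ℓ + 1) m := by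
  obtain ⟨u, hu, h⟩ := h
  refine ⟨Function.update u ℓ d, fun i j hij hj => ?_, fun j hj => ?_⟩
  · have hi : i ≠ ℓ := by omega
    by_cases hjl : j = ℓ
    · subst hjl
      simpa [hi] using (h i hij).1
    · simpa [hi, hjl] using hu i j hij (by omega)
  · by_cases hjl : j = ℓ
    · subst hjl
      simpa using ht
    · have := h j (by omega)
      simpa [hjl] using ⟨this.1.le, this.2⟩

/-! ### Nonvanishing of polynomials over infinite fields -/

section Eval

variable {σ L : Type*} [Field L]

theorem eval_eq_sum_prod (x : σ → L) (f : MvPolynomial σ L) :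
    eval x f = ∑ m ∈ f.support, coeff m f * m.prod fun v e => x v ^ e :=
  eval_eq x f

theorem eval_eq_eval_of_agree {x y : σ → L} {f : MvPolynomial σ L}
    (h : ∀ m ∈ f.support, ∀ v, m v ≠ 0 → x v = y v) : eval x f = eval y f := by
  rw [eval_eq, eval_eq]
  refine Finset.sum_congr rfl fun m hm => ?_
  congr 1
  refine Finset.prod_congr rfl fun v hv => ?_
  rw [h m hm v (Finsupp.mem_support_iff.1 hv)]

variable [Infinite L]

theorem exists_polynomial_eval_ne_zero {p : Polynomial L} (hp : p ≠ 0) : ∃ s, p.eval s ≠ 0 := by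
  by_contra! h
  exact hp (Polynomial.funext fun s => by simp [h s])

theorem exists_mvPolynomial_eval_ne_zero {f : MvPolynomial σ L} (hf : f ≠ 0) :
    ∃ x, eval x f ≠ 0 := by
  by_contra! h
  exact hf (MvPolynomial.funext fun s => by simp [h s])

/-- A nonvanishing polynomial stays nonvanishing when one coordinate is moved to a point outside
the zero of a nonconstant affine function. -/
theorem exists_update_eval_ne_zero [DecidableEq σ] {g : MvPolynomial σ L} {x : σ → L}
    (hg : eval x g ≠ 0) (v : σ) (a : L) {b : L} (hb : b ≠ 0) :
    ∃ s, eval (Function.update x v (x v + s)) g ≠ 0 ∧ a + b * s ≠ 0 := by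
  let Z : σ → Polynomial L := fun i => Polynomial.C (x i) + if i = v then Polynomial.X else 0
  let p : Polynomial L := aeval Z g
  have hp : ∀ s, p.eval s = eval (Function.update x v (x v + s)) g := by
    intro s
    have h1 : p.eval s = eval₂ (RingHom.id L) (fun i => (Z i).eval s) g := by
      simp only [p, aeval_def]
      rw [← Polynomial.coe_evalRingHom, ← coe_eval₂Hom, ← RingHom.comp_apply]
      rw [← coe_eval₂Hom]
      congr 1
      apply MvPolynomial.ringHom_ext <;> simp [Polynomial.coe_evalRingHom]
    rw [h1, eval₂_id]
    congr 2
    funext i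
    by_cases hi : i = v
    · subst hi; simp [Z]
    · simp [Z, hi]
  have hp0 : p ≠ 0 := by
    intro h
    apply hg
    have := hp 0
    simpa [h] using this.symm
  have hr0 : (Polynomial.C a + Polynomial.C b * Polynomial.X : Polynomial L) ≠ 0 := by
    intro h
    have := congrArg (fun q => Polynomial.coeff q 1) h
    simp at this
    exact hb this
  obtain ⟨s, hs⟩ := exists_polynomial_eval_ne_zero (mul_ne_zero hp0 hr0)
  rw [Polynomial.eval_mul, hp] at hs
  exact ⟨s, left_ne_zero_of_mul hs, by simpa using right_ne_zero_of_mul hs⟩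

/-- Moving along a curve `Z` on which the coordinate `t` has a pole `a / s`: if the part of `f` of
top degree in `t` does not vanish at `Z 0`, then `f` does not vanish at a general point of the
curve. -/
theorem exists_eval_ne_zero_of_pole [DecidableEq σ] (f : MvPolynomial σ L) (t : σ) (n : ℕ)
    (hn : ∀ m ∈ f.support, m t ≤ n) (Z : σ → Polynomial L) {a : L} (ha : a ≠ 0)
    (h0 : ∑ m ∈ f.support with m t = n,
      coeff m f * (m.erase t).prod (fun v e => (Z v).eval 0 ^ e) ≠ 0) :
    ∃ s ≠ 0, eval (Function.update (fun v => (Z v).eval s) t (a / s)) f ≠ 0 := by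
  -- `q` is `s ^ n` times the value of `f` along the curve, with the pole cleared; only the terms of
  -- degree `n` in `t` survive at `s = 0`.
  let q : Polynomial L := ∑ m ∈ f.support, Polynomial.C (coeff m f) *
    (Polynomial.C (a ^ m t) * Polynomial.X ^ (n - m t) * (m.erase t).prod fun v e => Z v ^ e)
  have hq : ∀ s, q.eval s = ∑ m ∈ f.support, coeff m f *
      (a ^ m t * s ^ (n - m t) * (m.erase t).prod fun v e => (Z v).eval s ^ e) := by
    intro s
    simp only [q, Polynomial.eval_finsetSum, Polynomial.eval_mul, Polynomial.eval_C,
      Polynomial.eval_pow, Polynomial.eval_X, Finsupp.prod, Polynomial.eval_prod]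
  have hq0 : q.eval 0 ≠ 0 := by
    have : q.eval 0 = a ^ n * ∑ m ∈ f.support with m t = n,
        coeff m f * (m.erase t).prod (fun v e => (Z v).eval 0 ^ e) := by
      rw [hq, Finset.sum_filter, Finset.mul_sum]
      refine Finset.sum_congr rfl fun m hm => ?_
      have := hn m hm
      split_ifs with h
      · rw [h]; simp; ring
      · rw [zero_pow (by omega)]; simp
    rw [this]
    exact mul_ne_zero (pow_ne_zero _ ha) h0
  -- The factor `X` forces the chosen `s` to be nonzero.
  have hqX : q * Polynomial.X ≠ 0 := by
    refine mul_ne_zero ?_ Polynomial.X_ne_zero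
    rintro h
    simp [h] at hq0
  obtain ⟨s, hs⟩ := exists_polynomial_eval_ne_zero hqX
  rw [Polynomial.eval_mul, Polynomial.eval_X] at hs
  have hs0 : s ≠ 0 := right_ne_zero_of_mul hs
  refine ⟨s, hs0, fun h => left_ne_zero_of_mul hs ?_⟩
  have : q.eval s = s ^ n * eval (Function.update (fun v => (Z v).eval s) t (a / s)) f := by
    rw [hq, eval_eq_sum_prod, Finset.mul_sum]
    refine Finset.sum_congr rfl fun m hm => ?_
    rw [← Finsupp.mul_prod_erase' m t _ (fun _ => pow_zero _)]
    have h1 : ((m.erase t).prod fun v e =>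
        Function.update (fun v => (Z v).eval s) t (a / s) v ^ e) =
        (m.erase t).prod fun v e => (Z v).eval s ^ e := by
      refine Finset.prod_congr rfl fun v hv => ?_
      have : v ≠ t := by
        rintro rfl
        simp at hv
      simp [this]
    rw [h1, Function.update_self, div_pow]
    have h2 : s ^ n = s ^ (n - m t) * s ^ m t := by
      rw [← pow_add, Nat.sub_add_cancel (hn m hm)]
    rw [h2]
    field_simp
  rw [this, h, mul_zero]

end Eval

/-! ### Chain-free polynomials and matrices with dependent columns -/

/-- A nonzero polynomial whose monomials contain no chain does not vanish at some matrix with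
linearly dependent columns, that is, it does not lie in the ideal of maximal minors. -/
theorem exists_dependent_eval_ne_zero {τ L : Type*} [Field L] [Infinite L] (d ℓ : ℕ)
    (f : MvPolynomial ((ℕ × ℕ) ⊕ τ) L) (hf : f ≠ 0) (h : ∀ m ∈ f.support, ¬ HasChain d ℓ m) :
    ∃ (x : (ℕ × ℕ) ⊕ τ → L) (w : ℕ → L), (∀ j, w j ≠ 0) ∧
      (∀ u < d, ∑ j ∈ Finset.range ℓ, x (Sum.inl (u, j)) * w j = 0) ∧ eval x f ≠ 0 := by
  classical
  induction d generalizing ℓ f with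
  | zero =>
    obtain ⟨x, hx⟩ := exists_mvPolynomial_eval_ne_zero hf
    exact ⟨x, fun _ => 1, by simp, by simp, hx⟩
  | succ d ih =>
    obtain ⟨m₀, hm₀, hmax⟩ := Finset.exists_max_image f.support (fun m => m (Sum.inl (d, ℓ - 1)))
      (support_nonempty.2 hf)
    have hℓ : ℓ ≠ 0 := by
      rintro rfl
      exact h m₀ hm₀ ⟨fun _ => 0, by simp, by simp⟩
    obtain ⟨ℓ, rfl⟩ := Nat.exists_eq_succ_of_ne_zero hℓ
    simp only [Nat.succ_eq_add_one, Nat.add_sub_cancel] at *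
    set t : (ℕ × ℕ) ⊕ τ := Sum.inl (d, ℓ) with ht
    by_cases hn : m₀ t = 0
    -- The corner variable `t` does not occur in `f`, so it is free to be solved for in the relation
    -- of the last row.
    · obtain ⟨x, w, hw, hxw, hx⟩ := ih (ℓ + 1) f hf fun m hm hc => h m hm hc.mono
      set ρ := ∑ j ∈ Finset.range ℓ, x (Sum.inl (d, j)) * w j with hρ
      refine ⟨Function.update x t (-ρ / w ℓ), w, hw, fun u hu => ?_, ?_⟩
      · rcases Nat.lt_succ_iff_lt_or_eq.1 hu with hu | rfl
        · rw [← hxw u hu]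
          refine Finset.sum_congr rfl fun j _ => ?_
          rw [Function.update_of_ne]
          simp [ht]; omega
        · rw [Finset.sum_range_succ, ht, Function.update_self, div_mul_cancel₀ _ (hw ℓ), hρ,
            add_neg_eq_zero]
          refine Finset.sum_congr rfl fun j hj => ?_
          rw [Function.update_of_ne]
          have := Finset.mem_range.1 hj
          simp; omega
      · rwa [eval_eq_eval_of_agree (y := x)]
        intro m hm v hv
        rw [Function.update_of_ne]
        rintro rfl
        have := hmax m hm
        omega
    · set n := m₀ t with hnt
      -- The part of `f` of top degree in `t`. All its monomials contain `t`, so a chain in the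
      -- remaining rows and columns would extend by `t` to a forbidden one.
      let g : MvPolynomial ((ℕ × ℕ) ⊕ τ) L :=
        ∑ m ∈ f.support with m t = n, monomial m (coeff m f)
      have hgc : ∀ m, coeff m g = if m t = n then coeff m f else 0 := by
        intro m
        simp only [g, coeff_sum, coeff_monomial]
        rw [Finset.sum_ite_eq']
        by_cases hm : m t = n <;> simp [hm]
        exact fun h => h.symm
      have hgs : g.support = f.support.filter fun m => m t = n := by
        ext m
        simp [hgc, and_comm]
      have hg0 : g ≠ 0 := by
        rw [← support_nonempty, hgs]
        exact ⟨m₀, by simp [hm₀, hnt]⟩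
      obtain ⟨x₀, w, hw, hxw₀, hx₀⟩ := ih ℓ g hg0 fun m hm hc => by
        rw [hgs, Finset.mem_filter] at hm
        exact h m hm.1 (hc.snoc (by rw [← ht, hm.2]; exact hn))
      have hℓ0 : ℓ ≠ 0 := by
        rintro rfl
        rw [← support_nonempty] at hg0
        obtain ⟨m, hm⟩ := hg0
        rw [hgs, Finset.mem_filter] at hm
        refine h m hm.1 (HasChain.snoc ⟨fun _ => 0, by simp, by simp⟩ (by rw [← ht, hm.2]; exact hn))
      obtain ⟨ℓ', rfl⟩ := Nat.exists_eq_succ_of_ne_zero hℓ0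
      -- Row `d` is not yet constrained, so its entry in column 0 can be moved until the partial
      -- relation `ρ` is nonzero; this gives the corner entry `-ρ / s` a genuine pole.
      obtain ⟨s₀, hs₀, hρ₀⟩ := exists_update_eval_ne_zero hx₀ (Sum.inl (d, 0))
        (∑ j ∈ Finset.range (ℓ' + 1), x₀ (Sum.inl (d, j)) * w j) (hw 0)
      set x := Function.update x₀ (Sum.inl (d, 0)) (x₀ (Sum.inl (d, 0)) + s₀) with hxdef
      have hxw : ∀ u < d, ∑ j ∈ Finset.range (ℓ' + 1), x (Sum.inl (u, j)) * w j = 0 := by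
        intro u hu
        rw [← hxw₀ u hu]
        refine Finset.sum_congr rfl fun j _ => ?_
        rw [hxdef, Function.update_of_ne]
        simp; omega
      set ρ := ∑ j ∈ Finset.range (ℓ' + 1), x (Sum.inl (d, j)) * w j with hρ
      have hρ0 : ρ ≠ 0 := by
        convert hρ₀ using 1
        rw [hρ, Finset.sum_range_succ', Finset.sum_range_succ', hxdef, Function.update_self]
        have : ∀ j, Function.update x₀ (Sum.inl (d, 0)) (x₀ (Sum.inl (d, 0)) + s₀)
            (Sum.inl (d, j + 1)) = x₀ (Sum.inl (d, j + 1)) := by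
          intro j
          rw [Function.update_of_ne]
          simp
        simp only [this]
        ring
      -- The last column gets weight `s`. In the rows before `d`, a correction of order `s` in
      -- column 0 restores the relation; at `s = 0` the curve passes through `x`.
      let Z : (ℕ × ℕ) ⊕ τ → Polynomial L := fun v => Polynomial.C (x v) -
        Sum.elim (fun p => if p.2 = 0 ∧ p.1 < d then
          Polynomial.C ((w 0)⁻¹ * x (Sum.inl (p.1, ℓ' + 1))) * Polynomial.X else 0)
          (fun _ => 0) v
      have hZ0 : ∀ v, (Z v).eval 0 = x v := by
        rintro (p | v)
        · simp only [Z, Sum.elim_inl]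
          split_ifs <;> simp
        · simp [Z]
      obtain ⟨s, hs, hfs⟩ := exists_eval_ne_zero_of_pole f t n hmax Z (neg_ne_zero.2 hρ0) (by
        intro h0
        apply hs₀
        rw [eval_eq_sum_prod, hgs]
        simp only [hZ0] at h0
        calc _ = ∑ m ∈ f.support with m t = n,
              x t ^ n * (coeff m f * (m.erase t).prod (fun v e => x v ^ e)) := by
              refine Finset.sum_congr rfl fun m hm => ?_
              have hm2 := (Finset.mem_filter.1 hm).2
              rw [← Finsupp.mul_prod_erase' m t _ (fun _ => pow_zero _), hgc, if_pos hm2, hm2]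
              ring
          _ = 0 := by rw [← Finset.mul_sum, h0, mul_zero])
      refine ⟨_, Function.update w (ℓ' + 1) s, fun j => ?_, fun u hu => ?_, hfs⟩
      · by_cases hj : j = ℓ' + 1
        · subst hj; simpa using hs
        · simpa [hj] using hw j
      · have hw' : ∀ j ∈ Finset.range (ℓ' + 1), Function.update w (ℓ' + 1) s j = w j := by
          intro j hj
          have := Finset.mem_range.1 hj
          rw [Function.update_of_ne]
          omega
        have hnt : ∀ u j, (u, j) ≠ (d, ℓ' + 1) →
            Function.update (fun v => (Z v).eval s) t (-ρ / s) (Sum.inl (u, j)) =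
            (Z (Sum.inl (u, j))).eval s := by
          intro u j huj
          rw [Function.update_of_ne]
          simpa [ht] using huj
        rw [Finset.sum_range_succ, Function.update_self]
        rcases Nat.lt_succ_iff_lt_or_eq.1 hu with hu | rfl
        · have hne : ∀ j, (u, j) ≠ (d, ℓ' + 1) := by
            intro j
            simp; omega
          have h1 := hxw u hu
          rw [Finset.sum_range_succ'] at h1
          rw [Finset.sum_congr rfl fun j hj => by rw [hnt _ _ (hne j), hw' j hj], hnt _ _ (hne _),
            Finset.sum_range_succ']
          simp only [Z, Sum.elim_inl, hu]
          simp
          have := hw 0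
          field_simp
          linear_combination h1
        · rw [ht, Function.update_self, div_mul_cancel₀ _ hs, ← ht, hρ, add_neg_eq_zero]
          refine Finset.sum_congr rfl fun j hj => ?_
          rw [hw' j hj, hnt]
          · simp [Z]
          · have := Finset.mem_range.1 hj
            simp; omega


/-! ### A Gröbner basis criterion via standard monomials -/

section Groebner

variable {σ K : Type*} [Field K] {m : MonomialOrder σ} {G G' : Set (MvPolynomial σ K)}
  {J : Ideal (MvPolynomial σ K)}

/-- A subset `G` of `J` is a Gröbner basis as soon as the monomials which are divisible by no leading
monomial of `G` are linearly independent modulo `J`. -/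
theorem isGroebnerBasis_of_standard (hfin : G.Finite) (hG : G ⊆ J) (h0 : ∀ g ∈ G, g ≠ 0)
    (h : ∀ f ∈ J, (∀ c ∈ f.support, ∀ g ∈ G, ¬ m.degree g ≤ c) → f = 0) :
    Ideal.span G = J ∧ IsGroebnerBasis m G J := by
  have hdiv : ∀ f ∈ J, ∃ q : G →₀ MvPolynomial σ K,
      f = Finsupp.linearCombination _ (fun b : G => (b : MvPolynomial σ K)) q ∧
      ∀ b : G, m.degree ((b : MvPolynomial σ K) * q b) ≼[m] m.degree f := by
    intro f hf
    obtain ⟨q, r, hqr, hdeg, hr⟩ := m.div_set (B := G)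
      (fun b hb => (m.leadingCoeff_ne_zero_iff.2 (h0 b hb)).isUnit) f
    -- The remainder of the division is standard and differs from `f` by an element of `J`.
    have hr0 : r = 0 := by
      refine h r ?_ hr
      have : r = f - Finsupp.linearCombination _ (fun b : G => (b : MvPolynomial σ K)) q := by
        rw [eq_sub_iff_add_eq, add_comm]
        exact hqr.symm
      rw [this]
      refine J.sub_mem hf ?_
      rw [Finsupp.linearCombination_apply]
      exact J.sum_mem fun b _ => J.mul_mem_left _ (hG b.2)
    exact ⟨q, by rw [hqr, hr0, add_zero] , hdeg⟩
  refine ⟨le_antisymm (Ideal.span_le.2 hG) fun f hf => ?_, hfin, hG,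
    le_antisymm (Ideal.span_mono (Set.image_mono hG)) (Ideal.span_le.2 ?_)⟩
  · obtain ⟨q, hq, -⟩ := hdiv f hf
    rw [hq, Finsupp.linearCombination_apply]
    exact Ideal.sum_mem _ fun b _ => Ideal.mul_mem_left _ _ (Ideal.subset_span b.2)
  · rintro _ ⟨f, hf, rfl⟩
    by_cases hf0 : f = 0
    · simp [hf0]
    obtain ⟨q, hq, hdeg⟩ := hdiv f hf
    have hc : coeff (m.degree f) f ≠ 0 := m.coeff_degree_ne_zero_iff.2 hf0
    -- Some summand must contribute to the top monomial of `f`; the degree bound of the division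
    -- makes this its own leading monomial.
    obtain ⟨b, -, hb⟩ : ∃ b ∈ q.support, coeff (m.degree f) (q b * (b : MvPolynomial σ K)) ≠ 0 := by
      by_contra! hcon
      apply hc
      have hq' := congrArg (coeff (m.degree f)) hq
      rw [hq', Finsupp.linearCombination_apply, Finsupp.sum, coeff_sum]
      exact Finset.sum_eq_zero hcon
    rw [mul_comm] at hb
    have hbq : (b : MvPolynomial σ K) * q b ≠ 0 := by
      rintro h
      simp [h] at hb
    have hle : m.degree f = m.degree (b : MvPolynomial σ K) + m.degree (q b) := by
      rw [← m.degree_mul (left_ne_zero_of_mul hbq) (right_ne_zero_of_mul hbq)]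
      refine m.toSyn.injective (le_antisymm (m.le_degree (mem_support_iff.2 hb)) (hdeg b))
    have hlt : m.leadingTerm f = monomial (m.degree (q b))
        (m.leadingCoeff f * (m.leadingCoeff (b : MvPolynomial σ K))⁻¹) *
          m.leadingTerm (b : MvPolynomial σ K) := by
      have := m.leadingCoeff_ne_zero_iff.2 (left_ne_zero_of_mul hbq)
      rw [MonomialOrder.leadingTerm, MonomialOrder.leadingTerm, monomial_mul, hle, add_comm,
        inv_mul_cancel_right₀ this]
    rw [hlt]
    exact Ideal.mul_mem_left _ _ (Ideal.subset_span ⟨b, b.2, rfl⟩)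

theorem IsGroebnerBasis.mono (h : IsGroebnerBasis m G J) (hGG' : G ⊆ G') (hfin : G'.Finite)
    (hG' : G' ⊆ J) : IsGroebnerBasis m G' J :=
  ⟨hfin, hG', le_antisymm (Ideal.span_mono (Set.image_mono hG'))
    (h.2.2 ▸ Ideal.span_mono (Set.image_mono hGG'))⟩

end Groebner

/-! ### Leading monomials of minors and minimality of `G(I_0)` -/

section Minors

variable {K : Type*} [Field K] {k ℓ d : ℕ}

theorem minor_eq_det {n : ℕ} (A : Finset (Fin d)) (B : Finset (Col k ℓ)) (h : A.card = B.card)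
    (hA : A.card = n) (hB : B.card = n) :
    minor K A B h = Matrix.det (Matrix.of fun r c : Fin n =>
      (X (var (A.orderEmbOfFin hA r) (B.orderEmbOfFin hB c)) : PolyRing K k ℓ d)) := by
  subst hA
  rfl

/-- The diagonal monomial of the minor with rows `a` and columns `b`. -/
noncomputable def diagMonomial {n : ℕ} (a : Fin n → Fin d) (b : Fin n → Col k ℓ) : Var k ℓ d →₀ ℕ :=
  ∑ r, Finsupp.single (var (a r) (b r)) 1

theorem var_eq_var_iff {u u' : Fin d} {b b' : Col k ℓ} :
    var u b = var u' b' ↔ u = u' ∧ b = b' := by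
  simp [var]

theorem var_lt_iff {u u' : Fin d} {b b' : Col k ℓ} :
    var u b < var u' b' ↔ u < u' ∨ u = u' ∧ b < b' := by
  simp [var, Prod.Lex.toLex_lt_toLex]

theorem diagMonomial_apply {n : ℕ} (a : Fin n → Fin d) (b : Fin n → Col k ℓ) (u : Fin d)
    (c : Col k ℓ) :
    diagMonomial a b (var u c) = (Finset.univ.filter fun r => a r = u ∧ b r = c).card := by
  classical
  simp only [diagMonomial, Finsupp.finsetSum_apply, Finsupp.single_apply, var_eq_var_iff]
  simp

/-- At the first index `r` moved by `π` one has `π r > r`. The two monomials agree in all variables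
larger than the one at `(a r, b r)`, and that variable divides only the diagonal monomial. -/
theorem diagMonomial_perm_lt {n : ℕ} {a : Fin n → Fin d} {b : Fin n → Col k ℓ}
    (ha : StrictMono a) (hb : StrictMono b) {π : Equiv.Perm (Fin n)} (hπ : π ≠ 1) :
    diagMonomial a (b ∘ π) ≺[lexOrder k ℓ d] diagMonomial a b := by
  classical
  have hne : (Finset.univ.filter fun r => π r ≠ r).Nonempty := by
    by_contra hcon
    rw [Finset.not_nonempty_iff_eq_empty, Finset.filter_eq_empty_iff] at hcon
    exact hπ (Equiv.ext fun r => not_not.1 (hcon (Finset.mem_univ r)))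
  set r := (Finset.univ.filter fun r => π r ≠ r).min' hne with hr
  have hπr : π r ≠ r := (Finset.mem_filter.1 (Finset.min'_mem _ hne)).2
  have hmin : ∀ r' < r, π r' = r' := by
    intro r' hr'
    by_contra hcon
    exact absurd (Finset.min'_le _ r' (Finset.mem_filter.2 ⟨Finset.mem_univ _, hcon⟩))
      (not_le.2 hr')
  have hlt : r < π r := by
    refine lt_of_le_of_ne (le_of_not_gt fun hlt => ?_) (Ne.symm hπr)
    exact hπr (π.injective (hmin _ hlt))
  rw [lexOrder, MonomialOrder.lex_lt_iff, Finsupp.Lex.lt_iff]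
  refine ⟨var (a r) (b r), fun v hv => ?_, ?_⟩
  · obtain ⟨u, c, rfl⟩ : ∃ u c, v = var u c := ⟨(ofLex v).1, (ofLex v).2, rfl⟩
    rw [var_lt_iff] at hv
    simp only [ofLex_toLex, diagMonomial_apply, Function.comp]
    congr 1
    refine Finset.filter_congr fun s _ => and_congr_right fun hs => ?_
    subst hs
    rcases hv with hv | ⟨hv, hc⟩
    · rw [hmin s (ha.lt_iff_lt.1 hv)]
    · have hsr := ha.injective hv
      subst hsr
      have := hb hlt
      constructor
      · rintro rfl
        exact absurd hc (not_lt.2 this.le)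
      · rintro rfl
        exact absurd hc (lt_irrefl _)
  · simp only [ofLex_toLex, diagMonomial_apply, Function.comp]
    rw [Finset.card_eq_zero.2, Finset.card_pos]
    · exact ⟨r, by simp⟩
    · rw [Finset.filter_eq_empty_iff]
      rintro s - ⟨h1, h2⟩
      rw [ha.injective h1] at h2
      exact hπr (hb.injective h2)

theorem degree_det_X {n : ℕ} {a : Fin n → Fin d} {b : Fin n → Col k ℓ}
    (ha : StrictMono a) (hb : StrictMono b) :
    (lexOrder k ℓ d).degree (Matrix.det (Matrix.of fun r c : Fin n =>
      (X (var (a r) (b c)) : PolyRing K k ℓ d))) = diagMonomial a b := by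
  classical
  set f := Matrix.det (Matrix.of fun r c : Fin n =>
      (X (var (a r) (b c)) : PolyRing K k ℓ d)) with hf
  have hfe : f = ∑ π : Equiv.Perm (Fin n),
      monomial (diagMonomial a (b ∘ π)) ((Equiv.Perm.sign π : ℤ) : K) := by
    rw [hf, ← Matrix.det_transpose, Matrix.det_apply']
    refine Finset.sum_congr rfl fun π _ => ?_
    have : ∏ i, (X (var (a i) (b (π i))) : PolyRing K k ℓ d) =
        monomial (diagMonomial a (b ∘ π)) 1 := by
      simp only [diagMonomial, MvPolynomial.X, Function.comp]
      rw [monomial_sum_one]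
    simp only [Matrix.transpose_apply, Matrix.of_apply]
    rw [this, ← mul_one ((Equiv.Perm.sign π : ℤ) : K), ← C_mul_monomial]
    simp
  have hcoeff : coeff (diagMonomial a b) f = 1 := by
    rw [hfe, coeff_sum, Finset.sum_eq_single 1]
    · simp
    · intro π _ hπ
      rw [coeff_monomial, if_neg]
      intro h
      have := diagMonomial_perm_lt ha hb hπ
      rw [h] at this
      exact lt_irrefl _ this
    · simp
  apply (lexOrder k ℓ d).toSyn.injective
  refine le_antisymm ((lexOrder k ℓ d).degree_le_iff.2 fun c hc => ?_)
    ((lexOrder k ℓ d).le_degree (by rw [mem_support_iff, hcoeff]; exact one_ne_zero))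
  rw [mem_support_iff, hfe, coeff_sum] at hc
  obtain ⟨π, -, hπ⟩ := Finset.exists_ne_zero_of_sum_ne_zero hc
  rw [coeff_monomial] at hπ
  have hcπ : diagMonomial a (b ∘ π) = c := by
    by_contra h
    simp [h] at hπ
  rw [← hcπ]
  by_cases h1 : π = 1
  · subst h1
    exact le_rfl
  · exact (diagMonomial_perm_lt ha hb h1).le

theorem minor_image {n : ℕ} {a : Fin n → Fin d} {b : Fin n → Col k ℓ}
    (ha : StrictMono a) (hb : StrictMono b)
    (h : (Finset.univ.image a).card = (Finset.univ.image b).card) :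
    minor K (Finset.univ.image a) (Finset.univ.image b) h =
      Matrix.det (Matrix.of fun r c : Fin n => (X (var (a r) (b c)) : PolyRing K k ℓ d)) := by
  have hA : (Finset.univ.image a).card = n := by
    rw [Finset.card_image_of_injective _ ha.injective, Finset.card_univ, Fintype.card_fin]
  rw [minor_eq_det _ _ h hA (h ▸ hA),
    ← Finset.orderEmbOfFin_unique hA (f := a) (fun x => by simp) ha,
    ← Finset.orderEmbOfFin_unique (h ▸ hA) (f := b) (fun x => by simp) hb]

theorem hyperedgeMinors_finite (E : Set (Finset (Col k ℓ))) : (hyperedgeMinors K d E).Finite := by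
  refine Set.Finite.subset (Set.finite_range fun p : {p : Finset (Fin d) × Finset (Col k ℓ) //
    p.1.card = p.2.card} => minor K p.1.1 p.1.2 p.2) ?_
  rintro f ⟨A, B, h, -, rfl⟩
  exact ⟨⟨(A, B), h⟩, rfl⟩

theorem columnVars_finite (S : Finset (Col k ℓ)) : (columnVars K d S).Finite := by
  refine Set.Finite.subset (Set.finite_range fun v : Var k ℓ d => (X v : PolyRing K k ℓ d)) ?_
  rintro f ⟨u, b, -, rfl⟩
  exact ⟨_, rfl⟩

/-- The evaluation at the matrix with entries `1` at the diagonal positions of `[A | B]` and zeros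
elsewhere. -/
noncomputable def diagEval (K : Type*) [Field K] (A : Finset (Fin d)) (B : Finset (Col k ℓ))
    (h : A.card = B.card) : PolyRing K k ℓ d →+* K :=
  open Classical in
  eval fun v => if ∃ r, v = var (A.orderEmbOfFin rfl r) (B.orderEmbOfFin h.symm r) then 1 else 0

theorem diagEval_self (A : Finset (Fin d)) (B : Finset (Col k ℓ)) (h : A.card = B.card) :
    diagEval K A B h (minor K A B h) = 1 := by
  classical
  rw [minor, RingHom.map_det, diagEval]
  convert Matrix.det_one (n := Fin A.card) (R := K)
  ext r c
  simp only [RingHom.mapMatrix_apply, Matrix.map_apply, Matrix.of_apply, eval_X,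
    var_eq_var_iff, Matrix.one_apply, EmbeddingLike.apply_eq_iff_eq]
  congr 1
  simp [eq_comm]

/-- A row outside `A` or a column outside `B` is zero in the evaluated matrix. -/
theorem subset_of_diagEval_ne_zero (A A' : Finset (Fin d)) (B B' : Finset (Col k ℓ))
    (h : A.card = B.card) (h' : A'.card = B'.card)
    (hne : diagEval K A B h (minor K A' B' h') ≠ 0) : A' ⊆ A ∧ B' ⊆ B := by
  classical
  rw [minor, RingHom.map_det, diagEval] at hne
  constructor
  · intro u hu
    obtain ⟨r, rfl⟩ : ∃ r, A'.orderEmbOfFin rfl r = u := by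
      rw [← Set.mem_range, Finset.range_orderEmbOfFin]
      exact hu
    by_contra hcon
    refine hne (Matrix.det_eq_zero_of_row_eq_zero r fun c => ?_)
    simp only [RingHom.mapMatrix_apply, Matrix.map_apply, Matrix.of_apply, eval_X,
      var_eq_var_iff]
    rw [if_neg]
    rintro ⟨s, hs, -⟩
    exact hcon (hs ▸ Finset.orderEmbOfFin_mem _ _ _)
  · intro u hu
    obtain ⟨r, rfl⟩ : ∃ r, B'.orderEmbOfFin h'.symm r = u := by
      rw [← Set.mem_range, Finset.range_orderEmbOfFin]
      exact hu
    by_contra hcon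
    refine hne (Matrix.det_eq_zero_of_column_eq_zero r fun c => ?_)
    simp only [RingHom.mapMatrix_apply, Matrix.map_apply, Matrix.of_apply, eval_X,
      var_eq_var_iff]
    rw [if_neg]
    rintro ⟨s, -, hs⟩
    exact hcon (hs ▸ Finset.orderEmbOfFin_mem _ _ _)

/-- No generator in `G₀` lies in the ideal generated by the others. -/
theorem not_mem_span_G₀_diff (hℓ : 2 ≤ ℓ) {g : PolyRing K k ℓ d} (hg : g ∈ G₀ K k ℓ d) :
    g ∉ Ideal.span (G₀ K k ℓ d \ {g}) := by
  have key : ∀ f ∈ G₀ K k ℓ d, ∃ (A : Finset (Fin d)) (B : Finset (Col k ℓ))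
      (h : A.card = B.card), f = minor K A B h ∧
      ((∃ j, B ⊆ block j ∧ B.card = 2) ∨ (B.card = ℓ ∧ ∀ j : Fin ℓ, (B ∩ block j).card ≤ 1)) := by
    rintro f (⟨A, B, h, hB, rfl⟩ | ⟨A, B, h, hB, rfl⟩)
    · exact ⟨A, B, h, rfl, Or.inl hB⟩
    · exact ⟨A, B, h, rfl, Or.inr hB⟩
  obtain ⟨A, B, h, rfl, hB⟩ := key g hg
  intro hmem
  have hker : Ideal.span (G₀ K k ℓ d \ {minor K A B h}) ≤ RingHom.ker (diagEval K A B h) := by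
    rw [Ideal.span_le]
    rintro f ⟨hf, hfg⟩
    obtain ⟨A', B', h', rfl, hB'⟩ := key f hf
    rw [SetLike.mem_coe, RingHom.mem_ker]
    by_contra hne
    obtain ⟨hAA, hBB⟩ := subset_of_diagEval_ne_zero A A' B B' h h' hne
    -- The only threat is a 2-subset of a block inside a larger `B`, which is excluded because such
    -- a `B` meets each block at most once.
    have hcard : B.card ≤ B'.card := by
      rcases hB with ⟨j, hj, hB⟩ | ⟨hB, hj⟩ <;> rcases hB' with ⟨j', hj', hB'⟩ | ⟨hB', hj'⟩
      · omega
      · omega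
      · have := Finset.card_le_card (Finset.subset_inter hBB hj')
        have := hj j'
        omega
      · omega
    have e1 := Finset.eq_of_subset_of_card_le hBB hcard
    have e2 := Finset.eq_of_subset_of_card_le hAA (by omega)
    subst e1 e2
    exact hfg rfl
  have := hker hmem
  rw [RingHom.mem_ker, diagEval_self] at this
  exact one_ne_zero this

end Minors


/-! ### Exponent matrices determined by their margins -/

section Matrices

variable {d k : ℕ} {a a' : Fin d → Fin k → ℕ}

/-- If `a` were smaller than `a'` at `(u, i)`, the row sum would force a larger entry of `a` to the
left and the column sum a larger one below. These two nonzero entries lie in the forbidden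
north-west to south-east position. -/
theorem le_of_sums_eq_of_agree_before
    (ha : ∀ u u' i i', u < u' → i < i' → a u i ≠ 0 → a u' i' = 0)
    (hrow : ∀ u, ∑ i, a u i = ∑ i, a' u i) (hcol : ∀ i, ∑ u, a u i = ∑ u, a' u i)
    {u : Fin d} {i : Fin k} (h1 : ∀ u' < u, ∀ i', a u' i' = a' u' i')
    (h2 : ∀ i' > i, a u i' = a' u i') : a' u i ≤ a u i := by
  by_contra! hlt
  obtain ⟨i', hi'⟩ : ∃ i', a' u i' < a u i' := by
    by_contra! hcon
    exact (Finset.sum_lt_sum (fun i _ => hcon i) ⟨i, Finset.mem_univ _, hlt⟩).ne (hrow u)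
  obtain ⟨u', hu'⟩ : ∃ u', a' u' i < a u' i := by
    by_contra! hcon
    exact (Finset.sum_lt_sum (fun u _ => hcon u) ⟨u, Finset.mem_univ _, hlt⟩).ne (hcol i)
  have hii : i' < i := by
    rcases lt_trichotomy i' i with h | rfl | h
    · exact h
    · omega
    · have := h2 i' h
      omega
  have huu : u < u' := by
    rcases lt_trichotomy u u' with h | rfl | h
    · exact h
    · omega
    · have := h1 u' h i
      omega
  have := ha u u' i' i huu hii (by omega)
  omega

/-- A matrix of natural numbers whose support contains no two positions strictly in north-west to
south-east direction is determined by its row sums and its column sums. -/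
theorem eq_of_sums_eq (ha : ∀ u u' i i', u < u' → i < i' → a u i ≠ 0 → a u' i' = 0)
    (ha' : ∀ u u' i i', u < u' → i < i' → a' u i ≠ 0 → a' u' i' = 0)
    (hrow : ∀ u, ∑ i, a u i = ∑ i, a' u i) (hcol : ∀ i, ∑ u, a u i = ∑ u, a' u i) (u : Fin d)
    (i : Fin k) : a u i = a' u i := by
  -- Rows are compared from top to bottom and, within a row, columns from right to left.
  induction u using WellFoundedLT.induction generalizing i with
  | ind u ihu =>
    induction i using WellFoundedGT.induction with
    | ind i ihi =>
      refine le_antisymm ?_ ?_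
      · exact le_of_sums_eq_of_agree_before ha' (fun u => (hrow u).symm) (fun i => (hcol i).symm)
          (fun u' hu' i' => (ihu u' hu' i').symm) (fun i' hi' => (ihi i' hi').symm)
      · exact le_of_sums_eq_of_agree_before ha hrow hcol ihu ihi

end Matrices

/-! ### The parametrization by blocks of rank at most one -/

section Toric

variable {k ℓ d : ℕ}

/-- The block containing a column. -/
def blockIdx (b : Col k ℓ) : Fin ℓ := (ofLex b).1

@[simp]
theorem blockIdx_col (i : Fin k) (j : Fin ℓ) : blockIdx (col i j) = j := rfl

theorem exists_eq_col (b : Col k ℓ) : ∃ i j, b = col i j := ⟨(ofLex b).2, (ofLex b).1, rfl⟩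

theorem exists_eq_var (v : Var k ℓ d) : ∃ u i j, v = var u (col i j) :=
  ⟨(ofLex v).1, (ofLex (ofLex v).2).2, (ofLex (ofLex v).2).1, rfl⟩

theorem col_eq_col_iff {i i' : Fin k} {j j' : Fin ℓ} : col i j = col i' j' ↔ j = j' ∧ i = i' := by
  simp [col]

theorem col_lt_col_iff {i i' : Fin k} {j j' : Fin ℓ} :
    col i j < col i' j' ↔ j < j' ∨ j = j' ∧ i < i' := by
  simp [col, Prod.Lex.toLex_lt_toLex]

theorem mem_block_iff {b : Col k ℓ} {j : Fin ℓ} : b ∈ block j ↔ blockIdx b = j := by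
  obtain ⟨i, j', rfl⟩ := exists_eq_col b
  simp [block, col_eq_col_iff, eq_comm]

/-- The variable `x_{u,j}` in the parametrization `p_{u,b} = x_{u,j} y_b`, `b ∈ C_j`. -/
def rowVar (v : Var k ℓ d) : (ℕ × ℕ) ⊕ Col k ℓ :=
  Sum.inl (((ofLex v).1 : ℕ), (blockIdx (ofLex v).2 : ℕ))

/-- The variable `y_b` in the parametrization `p_{u,b} = x_{u,j} y_b`, `b ∈ C_j`. -/
def colVar (v : Var k ℓ d) : (ℕ × ℕ) ⊕ Col k ℓ := Sum.inr (ofLex v).2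

theorem rowVar_var (u : Fin d) (b : Col k ℓ) :
    rowVar (var u b) = Sum.inl ((u : ℕ), (blockIdx b : ℕ)) := rfl

theorem colVar_var (u : Fin d) (b : Col k ℓ) : colVar (var u b) = Sum.inr b := rfl

/-- The exponent of the image of a monomial under `p_{u,b} ↦ x_{u,j} y_b`, `b ∈ C_j`. -/
noncomputable def toricExp (m : Var k ℓ d →₀ ℕ) : (ℕ × ℕ) ⊕ Col k ℓ →₀ ℕ :=
  m.mapDomain rowVar + m.mapDomain colVar

theorem toricExp_inl (m : Var k ℓ d →₀ ℕ) (u : Fin d) (j : Fin ℓ) :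
    toricExp m (Sum.inl ((u : ℕ), (j : ℕ))) = ∑ i, m (var u (col i j)) := by
  classical
  induction m using Finsupp.induction_linear with
  | zero => simp [toricExp]
  | add f g hf hg =>
    simp only [Finsupp.add_apply, Finset.sum_add_distrib, ← hf, ← hg]
    simp only [toricExp, Finsupp.mapDomain_add, Finsupp.add_apply]
    ring
  | single v e =>
    obtain ⟨u', i', j', rfl⟩ := exists_eq_var v
    simp only [toricExp, Finsupp.mapDomain_single, rowVar_var, colVar_var, Finsupp.add_apply,
      Finsupp.single_apply, var_eq_var_iff, col_eq_col_iff]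
    by_cases hu : u' = u <;> by_cases hj : j' = j <;>
      simp [hu, hj, Fin.val_inj]

theorem toricExp_inr (m : Var k ℓ d →₀ ℕ) (b : Col k ℓ) :
    toricExp m (Sum.inr b) = ∑ u, m (var u b) := by
  classical
  induction m using Finsupp.induction_linear with
  | zero => simp [toricExp]
  | add f g hf hg =>
    simp only [Finsupp.add_apply, Finset.sum_add_distrib, ← hf, ← hg]
    simp only [toricExp, Finsupp.mapDomain_add, Finsupp.add_apply]
    ring
  | single v e =>
    obtain ⟨u', i', j', rfl⟩ := exists_eq_var v
    simp only [toricExp, Finsupp.mapDomain_single, rowVar_var, colVar_var, Finsupp.add_apply,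
      Finsupp.single_apply, var_eq_var_iff]
    by_cases hb : col i' j' = b <;> simp [hb]

/-- The monomial is divisible by no leading monomial of a `2`-minor within a block. -/
def BlockStandard (m : Var k ℓ d →₀ ℕ) : Prop :=
  ∀ j u u' i i', u < u' → i < i' → m (var u (col i j)) ≠ 0 → m (var u' (col i' j)) = 0

/-- Within block `j`, the exponents of the `x_{u,j}` are the row sums and those of the `y_b` the
column sums of the exponent matrix. -/
theorem toricExp_injOn : Set.InjOn toricExp {m : Var k ℓ d →₀ ℕ | BlockStandard m} := by
  intro m hm m' hm' h
  ext v
  obtain ⟨u, i, j, rfl⟩ := exists_eq_var v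
  refine eq_of_sums_eq (a := fun u i => m (var u (col i j)))
    (a' := fun u i => m' (var u (col i j))) (hm j) (hm' j) (fun u => ?_) (fun i => ?_) u i
  · rw [← toricExp_inl, ← toricExp_inl, h]
  · rw [← toricExp_inr, ← toricExp_inr, h]

variable {K : Type*} [Field K] (L : Type*) [Field L] [Algebra K L]

/-- The image of a polynomial under `p_{u,b} ↦ x_{u,j} y_b`, `b ∈ C_j`. -/
noncomputable def toricImage (f : PolyRing K k ℓ d) : MvPolynomial ((ℕ × ℕ) ⊕ Col k ℓ) L :=
  ∑ m ∈ f.support, monomial (toricExp m) (algebraMap K L (coeff m f))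

variable {L}

theorem exists_of_mem_support_toricImage {f : PolyRing K k ℓ d}
    {n : (ℕ × ℕ) ⊕ Col k ℓ →₀ ℕ} (hn : n ∈ (toricImage L f).support) :
    ∃ m ∈ f.support, n = toricExp m := by
  classical
  rw [mem_support_iff, toricImage, coeff_sum] at hn
  obtain ⟨m, hm, hmn⟩ := Finset.exists_ne_zero_of_sum_ne_zero hn
  refine ⟨m, hm, ?_⟩
  by_contra h
  rw [coeff_monomial, if_neg (Ne.symm h)] at hmn
  exact hmn rfl

/-- Distinct block-standard monomials have distinct images, so no cancellation can occur. -/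
theorem toricImage_ne_zero {f : PolyRing K k ℓ d} (hf : f ≠ 0)
    (h : ∀ m ∈ f.support, BlockStandard m) : toricImage L f ≠ 0 := by
  classical
  obtain ⟨m, hm⟩ := support_nonempty.2 hf
  intro h0
  have hc : coeff (toricExp m) (toricImage L f) = algebraMap K L (coeff m f) := by
    rw [toricImage, coeff_sum, Finset.sum_eq_single m]
    · simp
    · intro m' hm' hne
      rw [coeff_monomial, if_neg]
      exact fun heq => hne (toricExp_injOn (h m' hm') (h m hm) heq)
    · exact fun hcon => absurd hm hcon
  rw [h0, coeff_zero] at hc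
  exact mem_support_iff.1 hm ((map_eq_zero _).1 hc.symm)

/-- The matrix with entries `p_{u,b} = x_{u,j} y_b`, `b ∈ C_j`. -/
def toricPoint (z : (ℕ × ℕ) ⊕ Col k ℓ → L) (v : Var k ℓ d) : L := z (rowVar v) * z (colVar v)

theorem aeval_toricPoint (z : (ℕ × ℕ) ⊕ Col k ℓ → L) (f : PolyRing K k ℓ d) :
    aeval (toricPoint z) f = eval z (toricImage L f) := by
  conv_lhs => rw [f.as_sum]
  rw [map_sum, toricImage, map_sum]
  refine Finset.sum_congr rfl fun m _ => ?_
  rw [aeval_monomial, eval_monomial]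
  congr 1
  rw [toricExp, Finsupp.prod_add_index' (fun _ => pow_zero _) (fun _ => pow_add _),
    Finsupp.prod_mapDomain_index (fun _ => pow_zero _) (fun _ => pow_add _),
    Finsupp.prod_mapDomain_index (fun _ => pow_zero _) (fun _ => pow_add _),
    ← Finsupp.prod_mul]
  simp only [toricPoint, mul_pow]

theorem aeval_toricPoint_minor {n : ℕ} (z : (ℕ × ℕ) ⊕ Col k ℓ → L) (A : Finset (Fin d))
    (B : Finset (Col k ℓ)) (h : A.card = B.card) (hA : A.card = n) (hB : B.card = n) :
    aeval (toricPoint z) (minor K A B h) = Matrix.det (Matrix.of fun r c : Fin n =>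
      z (Sum.inl ((A.orderEmbOfFin hA r : ℕ), (blockIdx (B.orderEmbOfFin hB c) : ℕ))) *
        z (Sum.inr (B.orderEmbOfFin hB c))) := by
  rw [minor_eq_det A B h hA hB, AlgHom.map_det]
  congr 1
  ext r c
  simp [toricPoint, rowVar_var, colVar_var]

theorem aeval_toricPoint_eq_zero_of_block (z : (ℕ × ℕ) ⊕ Col k ℓ → L) {f : PolyRing K k ℓ d}
    (hf : f ∈ hyperedgeMinors K d (blockEdges k ℓ 2)) : aeval (toricPoint z) f = 0 := by
  obtain ⟨A, B, h, ⟨j, hj, hB⟩, rfl⟩ := hf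
  have hb : ∀ c, blockIdx (B.orderEmbOfFin hB c) = j := fun c =>
    mem_block_iff.1 (hj (Finset.orderEmbOfFin_mem _ _ _))
  rw [aeval_toricPoint_minor z A B h (h.trans hB) hB, Matrix.det_fin_two]
  simp only [Matrix.of_apply, hb]
  ring

/-- The evaluated submatrix factors through the rows `A` of `x`, an `ℓ × ℓ` matrix with `w` in its
kernel. Transversality of the columns plays no role. -/
theorem aeval_toricPoint_eq_zero_of_dependent (z : (ℕ × ℕ) ⊕ Col k ℓ → L) (w : ℕ → L)
    (hw : ∀ j, w j ≠ 0) (hzw : ∀ u < d, ∑ j ∈ Finset.range ℓ, z (Sum.inl (u, j)) * w j = 0)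
    (hℓ : ℓ ≠ 0) {f : PolyRing K k ℓ d} (hf : f ∈ hyperedgeMinors K d (allEdges k ℓ ℓ)) :
    aeval (toricPoint z) f = 0 := by
  classical
  obtain ⟨A, B, h, hB, rfl⟩ := hf
  replace hB : B.card = ℓ := hB
  rw [aeval_toricPoint_minor z A B h (h.trans hB) hB]
  let M : Matrix (Fin ℓ) (Fin ℓ) L :=
    Matrix.of fun r j => z (Sum.inl ((A.orderEmbOfFin (h.trans hB) r : ℕ), (j : ℕ)))
  let N : Matrix (Fin ℓ) (Fin ℓ) L := Matrix.of fun j c =>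
    if blockIdx (B.orderEmbOfFin hB c) = j then z (Sum.inr (B.orderEmbOfFin hB c)) else 0
  have hM : M.det = 0 := by
    rw [← Matrix.exists_mulVec_eq_zero_iff]
    refine ⟨fun j => w j, fun h0 => hw 0 (congrFun h0 ⟨0, Nat.pos_of_ne_zero hℓ⟩), ?_⟩
    ext r
    have := hzw (A.orderEmbOfFin (h.trans hB) r) (Fin.is_lt _)
    rw [← Fin.sum_univ_eq_sum_range
      (fun j => z (Sum.inl ((A.orderEmbOfFin (h.trans hB) r : ℕ), j)) * w j)] at this
    simpa [Matrix.mulVec, dotProduct, M] using this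
  rw [show (Matrix.of fun r c : Fin ℓ => z (Sum.inl ((A.orderEmbOfFin (h.trans hB) r : ℕ),
    (blockIdx (B.orderEmbOfFin hB c) : ℕ))) * z (Sum.inr (B.orderEmbOfFin hB c))) = M * N from ?_,
    Matrix.det_mul, hM, zero_mul]
  ext r c
  simp [Matrix.mul_apply, M, N]

/-- Injectivity of `a` makes the diagonal monomial squarefree, so divisibility can be tested one
variable at a time. -/
theorem diagMonomial_le {n : ℕ} {a : Fin n → Fin d} {b : Fin n → Col k ℓ} (ha : StrictMono a)
    {m : Var k ℓ d →₀ ℕ} (h : ∀ r, m (var (a r) (b r)) ≠ 0) : diagMonomial a b ≤ m := by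
  classical
  intro v
  obtain ⟨u, i, j, rfl⟩ := exists_eq_var v
  rw [diagMonomial_apply]
  rcases Finset.eq_empty_or_nonempty
    (Finset.univ.filter fun r => a r = u ∧ b r = col i j) with h0 | ⟨r, hr⟩
  · simp [h0]
  · refine le_trans (Finset.card_le_one.2 fun r hr s hs => ha.injective ?_) (Nat.one_le_iff_ne_zero.2 ?_)
    · rw [(Finset.mem_filter.1 hr).2.1, (Finset.mem_filter.1 hs).2.1]
    · rw [← (Finset.mem_filter.1 hr).2.1, ← (Finset.mem_filter.1 hr).2.2]
      exact h r

theorem exists_minor_degree_le (K : Type*) [Field K] {n : ℕ} {a : Fin n → Fin d}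
    {b : Fin n → Col k ℓ} (ha : StrictMono a) (hb : StrictMono b) {m : Var k ℓ d →₀ ℕ}
    (h : ∀ r, m (var (a r) (b r)) ≠ 0) {E : Set (Finset (Col k ℓ))}
    (hE : Finset.univ.image b ∈ E) :
    ∃ g ∈ hyperedgeMinors K d E, (lexOrder k ℓ d).degree g ≤ m := by
  have hc : (Finset.univ.image a).card = (Finset.univ.image b).card := by
    rw [Finset.card_image_of_injective _ ha.injective, Finset.card_image_of_injective _ hb.injective]
  refine ⟨_, ⟨_, _, hc, hE, rfl⟩, ?_⟩
  rw [minor_image ha hb, degree_det_X ha hb]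
  exact diagMonomial_le ha h

theorem exists_two_minor_degree_le (K : Type*) [Field K] {m : Var k ℓ d →₀ ℕ} {j : Fin ℓ}
    {u u' : Fin d} {i i' : Fin k} (hu : u < u') (hi : i < i') (h : m (var u (col i j)) ≠ 0)
    (h' : m (var u' (col i' j)) ≠ 0) {E : Set (Finset (Col k ℓ))}
    (hE : ({col i j, col i' j} : Finset (Col k ℓ)) ∈ E) :
    ∃ g ∈ hyperedgeMinors K d E, (lexOrder k ℓ d).degree g ≤ m := by
  have hlt : col i j < col i' j := col_lt_col_iff.2 (Or.inr ⟨rfl, hi⟩)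
  refine exists_minor_degree_le K (a := ![u, u']) (b := ![col i j, col i' j]) ?_ ?_ ?_ ?_
  · rw [Fin.strictMono_iff_lt_succ]
    simpa using hu
  · rw [Fin.strictMono_iff_lt_succ]
    simpa using hlt
  · simpa [Fin.forall_fin_two] using ⟨h, h'⟩
  · convert hE
    ext x
    simp [Fin.exists_fin_two, eq_comm]

end Toric

/-! ### The Gröbner bases of `I_0` and `I_S` -/

section Main

variable {K : Type*} [Field K] {k ℓ d : ℕ}

theorem minor_ne_zero (A : Finset (Fin d)) (B : Finset (Col k ℓ)) (h : A.card = B.card) :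
    minor K A B h ≠ 0 := by
  intro h0
  have := diagEval_self (K := K) A B h
  simp [h0] at this

theorem ne_zero_of_mem_hyperedgeMinors {E : Set (Finset (Col k ℓ))} {g : PolyRing K k ℓ d}
    (hg : g ∈ hyperedgeMinors K d E) : g ≠ 0 := by
  obtain ⟨A, B, h, -, rfl⟩ := hg
  exact minor_ne_zero A B h

theorem hyperedgeMinors_mono {E E' : Set (Finset (Col k ℓ))} (h : E ⊆ E') :
    hyperedgeMinors K d E ⊆ hyperedgeMinors K d E' := by
  rintro f ⟨A, B, hc, hB, rfl⟩
  exact ⟨A, B, hc, h hB, rfl⟩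

theorem pair_mem_blockEdges {i i' : Fin k} (hi : i ≠ i') (j : Fin ℓ) :
    ({col i j, col i' j} : Finset (Col k ℓ)) ∈ blockEdges k ℓ 2 := by
  refine ⟨j, ?_, Finset.card_pair fun h => hi (col_eq_col_iff.1 h).2⟩
  intro b hb
  rw [mem_block_iff]
  rcases Finset.mem_insert.1 hb with rfl | hb
  · rfl
  · rw [Finset.mem_singleton.1 hb]
    rfl

theorem groebner_G₀ (hℓ : 2 ≤ ℓ) : Ideal.span (G₀ K k ℓ d) = I₀ K k ℓ d ∧
    IsGroebnerBasis (lexOrder k ℓ d) (G₀ K k ℓ d) (I₀ K k ℓ d) := by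
  refine isGroebnerBasis_of_standard
    ((hyperedgeMinors_finite _).union (hyperedgeMinors_finite _)) ?_ ?_ ?_
  · rintro f (hf | hf)
    · exact Ideal.subset_span (hyperedgeMinors_mono Set.subset_union_left hf)
    · exact Ideal.subset_span (hyperedgeMinors_mono (fun B hB => Or.inr hB.1) hf)
  · rintro g (hg | hg) <;> exact ne_zero_of_mem_hyperedgeMinors hg
  · intro f hf hstd
    by_contra hf0
    have hblock : ∀ m ∈ f.support, BlockStandard m := by
      intro m hm j u u' i i' hu hi h
      by_contra h'
      obtain ⟨g, hg, hgm⟩ :=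
        exists_two_minor_degree_le K hu hi h h' (pair_mem_blockEdges hi.ne j)
      exact hstd m hm g (Or.inl hg) hgm
    -- The algebraic closure is infinite even when `K` is finite.
    obtain ⟨z, w, hw, hzw, hz⟩ := exists_dependent_eval_ne_zero d ℓ
      (toricImage (AlgebraicClosure K) f) (toricImage_ne_zero hf0 hblock) (by
        intro n hn hchain
        obtain ⟨m, hm, rfl⟩ := exists_of_mem_support_toricImage hn
        obtain ⟨u, hu, h⟩ := hchain
        -- A chain in the image lifts: a positive row sum in block `j` provides a column of that
        -- block. Since blocks are ordered, these columns increase with `j` and give the diagonal of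
        -- a transversal `ℓ`-minor dividing `m`.
        have hex : ∀ j : Fin ℓ, ∃ i : Fin k, m (var ⟨u j, (h j j.2).1⟩ (col i j)) ≠ 0 := by
          intro j
          have := (h j j.2).2
          rw [show u j = ((⟨u j, (h j j.2).1⟩ : Fin d) : ℕ) from rfl, toricExp_inl] at this
          obtain ⟨i, -, hi⟩ := Finset.exists_ne_zero_of_sum_ne_zero this
          exact ⟨i, hi⟩
        choose i hi using hex
        have hb : StrictMono fun j => col (i j) j := fun j j' hj => col_lt_col_iff.2 (Or.inl hj)
        obtain ⟨g, hg, hgm⟩ := exists_minor_degree_le K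
          (a := fun j : Fin ℓ => (⟨u j, (h j j.2).1⟩ : Fin d)) (b := fun j => col (i j) j)
          (fun j j' hj => hu j j' hj j'.2) hb hi
          (E := {B | B.card = ℓ ∧ ∀ j : Fin ℓ, (B ∩ block j).card ≤ 1}) (by
            refine ⟨by rw [Finset.card_image_of_injective _ hb.injective, Finset.card_fin],
              fun j => Finset.card_le_one.2 fun b hb b' hb' => ?_⟩
            simp only [Finset.mem_inter, Finset.mem_image, Finset.mem_univ, true_and,
              mem_block_iff] at hb hb'
            obtain ⟨⟨j₁, rfl⟩, h1⟩ := hb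
            obtain ⟨⟨j₂, rfl⟩, h2⟩ := hb'
            rw [blockIdx_col] at h1 h2
            rw [h1, h2])
        exact hstd m hm g (Or.inr hg) hgm)
    rw [← aeval_toricPoint] at hz
    have hker : I₀ K k ℓ d ≤ RingHom.ker (aeval (toricPoint z) :
        PolyRing K k ℓ d →ₐ[K] AlgebraicClosure K) := by
      refine Ideal.span_le.2 ?_
      rintro g ⟨A, B, h, hB | hB, rfl⟩
      · exact aeval_toricPoint_eq_zero_of_block z ⟨A, B, h, hB, rfl⟩
      · exact aeval_toricPoint_eq_zero_of_dependent z w hw hzw (by omega) ⟨A, B, h, hB, rfl⟩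
    exact hz (hker hf)

theorem span_gens (S : Finset (Col k ℓ)) : Ideal.span (gens K d S) = I K d S :=
  Ideal.span_union _ _

theorem reducedGens_subset_gens (S : Finset (Col k ℓ)) : reducedGens K d S ⊆ gens K d S :=
  Set.union_subset_union_right _ (hyperedgeMinors_mono fun _ ⟨j, hB, hc⟩ =>
    ⟨j, hB.trans Finset.sdiff_subset, hc⟩)

theorem gens_finite (S : Finset (Col k ℓ)) : (gens K d S).Finite :=
  (columnVars_finite S).union (hyperedgeMinors_finite _)

theorem gens_subset (S : Finset (Col k ℓ)) : gens K d S ⊆ I K d S := by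
  rw [← span_gens]
  exact Ideal.subset_span

theorem groebner_reducedGens (S : Finset (Col k ℓ)) :
    Ideal.span (reducedGens K d S) = I K d S ∧
      IsGroebnerBasis (lexOrder k ℓ d) (reducedGens K d S) (I K d S) := by
  classical
  refine isGroebnerBasis_of_standard ((gens_finite S).subset (reducedGens_subset_gens S))
    ((reducedGens_subset_gens S).trans (gens_subset S)) ?_ ?_
  · rintro g (⟨u, b, -, rfl⟩ | hg)
    · exact X_ne_zero _
    · exact ne_zero_of_mem_hyperedgeMinors hg
  · intro f hf hstd
    by_contra hf0
    have hS : ∀ m ∈ f.support, ∀ u, ∀ b ∈ S, m (var u b) = 0 := by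
      intro m hm u b hb
      by_contra h
      refine hstd m hm _ (Or.inl ⟨u, b, hb, rfl⟩) ?_
      rw [MonomialOrder.degree_X, Finsupp.single_le_iff]
      exact Nat.one_le_iff_ne_zero.2 h
    have hblock : ∀ m ∈ f.support, BlockStandard m := by
      intro m hm j u u' i i' hu hi h
      by_contra h'
      obtain ⟨g, hg, hgm⟩ := exists_two_minor_degree_le K hu hi h h'
        (E := {B | ∃ j : Fin ℓ, B ⊆ block j \ S ∧ B.card = 2}) (by
          refine ⟨j, fun b hb => Finset.mem_sdiff.2 ⟨?_, fun hbS => ?_⟩,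
            Finset.card_pair fun h => hi.ne (col_eq_col_iff.1 h).2⟩
          · rw [Finset.mem_insert, Finset.mem_singleton] at hb
            rcases hb with rfl | rfl <;> simp [mem_block_iff]
          · rw [Finset.mem_insert, Finset.mem_singleton] at hb
            rcases hb with rfl | rfl
            · exact h (hS m hm _ _ hbS)
            · exact h' (hS m hm _ _ hbS))
      exact hstd m hm g (Or.inr hg) hgm
    obtain ⟨y, hy⟩ := exists_mvPolynomial_eval_ne_zero
      (toricImage_ne_zero (L := AlgebraicClosure K) hf0 hblock)
    -- Killing `y_b` for `b ∈ S` makes the column variables vanish. It does not change the value of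
    -- the image of `f`, whose monomials avoid these `y_b`.
    set z : (ℕ × ℕ) ⊕ Col k ℓ → AlgebraicClosure K :=
      Sum.elim (fun p => y (Sum.inl p)) fun b => if b ∈ S then 0 else y (Sum.inr b) with hzdef
    have hz : eval z (toricImage (AlgebraicClosure K) f) ≠ 0 := by
      rwa [eval_eq_eval_of_agree (y := y)]
      rintro n hn (p | b) hv
      · rfl
      · have hb : b ∉ S := by
          intro hb
          obtain ⟨m, hm, rfl⟩ := exists_of_mem_support_toricImage hn
          rw [toricExp_inr] at hv
          exact hv (Finset.sum_eq_zero fun u _ => hS m hm u b hb)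
        simp [hzdef, hb]
    rw [← aeval_toricPoint] at hz
    have hker : I K d S ≤ RingHom.ker (aeval (toricPoint z) :
        PolyRing K k ℓ d →ₐ[K] AlgebraicClosure K) := by
      rw [← span_gens, Ideal.span_le]
      rintro g (⟨u, b, hb, rfl⟩ | hg)
      · simp [RingHom.mem_ker, toricPoint, colVar_var, hzdef, hb]
      · exact aeval_toricPoint_eq_zero_of_block z hg
    exact hz (hker hf)

end Main

end HiddenCI

theorem theorem2p4 (K : Type*) [Field K] (k ℓ d : ℕ) (hk : 2 ≤ k) (hkℓ : k ≤ ℓ) (hℓd : ℓ ≤ d) :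
    (HiddenCI.IsMinimalGeneratingSet (HiddenCI.G₀ K k ℓ d) (HiddenCI.I₀ K k ℓ d) ∧
      HiddenCI.IsGroebnerBasis (HiddenCI.lexOrder k ℓ d) (HiddenCI.G₀ K k ℓ d)
        (HiddenCI.I₀ K k ℓ d)) ∧
    ∀ S ∈ HiddenCI.𝓛 k ℓ,
      (Ideal.span (HiddenCI.gens K d S) = HiddenCI.I K d S ∧
        HiddenCI.IsGroebnerBasis (HiddenCI.lexOrder k ℓ d) (HiddenCI.gens K d S)
          (HiddenCI.I K d S)) ∧
      (Ideal.span (HiddenCI.reducedGens K d S) = HiddenCI.I K d S ∧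
        HiddenCI.IsGroebnerBasis (HiddenCI.lexOrder k ℓ d) (HiddenCI.reducedGens K d S)
          (HiddenCI.I K d S)) := by
  have hℓ : 2 ≤ ℓ := hk.trans hkℓ
  have hG₀ := HiddenCI.groebner_G₀ (K := K) (k := k) (d := d) hℓ
  refine ⟨⟨⟨hG₀.1, fun g hg => HiddenCI.not_mem_span_G₀_diff hℓ hg⟩, hG₀.2⟩, fun S _ => ?_⟩
  -- The smaller set suffices: a finite enlargement of a Gröbner basis inside the ideal remains one.
  have hred := HiddenCI.groebner_reducedGens (K := K) (d := d) S
  exact ⟨⟨HiddenCI.span_gens S, hred.2.mono (HiddenCI.reducedGens_subset_gens S)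
    (HiddenCI.gens_finite S) (HiddenCI.gens_subset S)⟩, hred⟩
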